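/- Identify subsets of $\omega$ with points of Cantor space $2^\omega$, let $\lambda$ be the uniform (fair-coin) product measure on $2^\omega$, and for a finite binary string $\sigma$ let $[\sigma]$ be the set of $X\in 2^\omega$ extending $\sigma$. Use the following definitions for an oracle $A\subseteq\omega$. - $A$ is of *hyperimmune degree* if there is a function $f\colon\omega\to\omega$ with $f\le_T A$ such that for no computable $g\colon\omega\to\omega$ does $f(n)\le g(n)$ hold for almost all $n$. - A *Kurtz test* is a sequence $(G_m)_{m\in\omega}$ of clopen subsets of $2^\omega$ with $\lambda(G_m)\le 2^{-m}$ for all $m$ that is effective, i.e. from $m$ one can compute a finite list $D_m$ of strings with $G_m=\bigcup_{\sigma\in D_m}[\sigma]$. A *Kurtz null set* is a set of the form $\bigcap_m G_m$ for a Kurtz test $(G_m)$. - A *Schnorr test relative to $A$* is a sequence $(G_m)_{m\in\omega}$ of uniformly $\Sigma^0_1(A)$ subsets of $2^\omega$ (i.e. $G_m=\bigcup_{\sigma\in W_m}[\sigma]$ with the sets of strings $W_m$ computably enumerable in $A$ uniformly in $m$) such that $\lambda(G_m)\le 2^{-m}$ for all $m$ and $\lambda(G_m)$ is an $A$-computable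 real uniformly in $m$. A set $N\subseteq 2^\omega$ is *Schnorr null relative to $A$* if $N\subseteq\bigcap_m G_m$ for some Schnorr test $(G_m)$ relative to $A$. - $A$ is *Schnorr-Kurtz engulfing* if the union of all Kurtz null sets is Schnorr null relative to $A$. **Theorem.** For every oracle $A$, the following are equivalent: (i) $A$ is of hyperimmune degree; (ii) $A$ is Schnorr-Kurtz engulfing. -/

import Mathlib

open MeasureTheory Filter

namespace SchnorrKurtz

/-- Cantor space `2^ω`; its elements (the reals) are identified with subsets of `ω` through
characteristic functions.  Turing oracles are also taken from here. -/
abbrev Cantor : Type := ℕ → Bool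

/-- The characteristic function of `A`, as the (total) oracle function `ℕ →. ℕ`. -/
def oracleFun (A : Cantor) : ℕ →. ℕ := fun n => Part.some (A n).toNat

/-- `f ≤_T A`: the total function `f` is computable with oracle `A`. -/
def ComputableFrom {α σ : Type} [Primcodable α] [Primcodable σ] (A : Cantor) (f : α → σ) : Prop :=
  ComputableIn {oracleFun A} f

/-- `A` is of hyperimmune degree: some `f ≤_T A` is not dominated by any computable function,
i.e. there is no computable `g` with `f n ≤ g n` for almost all `n`. -/
def IsOfHyperimmuneDegree (A : Cantor) : Prop :=
  ∃ f : ℕ → ℕ, ComputableFrom A f ∧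
    ∀ g : ℕ → ℕ, Computable g → ¬ ∀ᶠ n in atTop, f n ≤ g n

/-- The basic clopen set `[σ]` of all infinite sequences extending the finite string `σ`. -/
def cyl (σ : List Bool) : Set Cantor :=
  {X | ∀ (i : ℕ) (hi : i < σ.length), X i = σ[i]}

/-- The clopen set `⋃_{σ ∈ D} [σ]` with strong index the finite list `D` of strings.
By compactness, every clopen subset of Cantor space has this form. -/
def clopen (D : List (List Bool)) : Set Cantor := ⋃ σ ∈ D, cyl σ

/-- The uniform (fair coin) product measure on Cantor space. -/
noncomputable def coinMeasure : Measure Cantor :=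
  Measure.infinitePi fun _ : ℕ => (PMF.uniformOfFintype Bool).toMeasure

/-- A Kurtz test: an effective sequence of clopen sets (computably given by strong indices)
whose `m`-th member has measure at most `2^{-m}`. -/
def IsKurtzTest (G : ℕ → Set Cantor) : Prop :=
  (∃ D : ℕ → List (List Bool), Computable D ∧ ∀ m, G m = clopen (D m)) ∧
    ∀ m, coinMeasure (G m) ≤ (2⁻¹ : ENNReal) ^ m

/-- A Kurtz null set: the intersection of a Kurtz test. -/
def IsKurtzNull (K : Set Cantor) : Prop :=
  ∃ G : ℕ → Set Cantor, IsKurtzTest G ∧ K = ⋂ m, G m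

/-- `G` is a uniformly `Σ⁰₁(A)` sequence of open sets: `G m` is the union of the basic clopen
sets `[σ]` for `σ` in a set of strings that is enumerated with oracle `A`, uniformly in `m`
(at each stage the enumeration lists at most one string, so that empty sets are allowed). -/
def IsUniformlySigmaOneIn (A : Cantor) (G : ℕ → Set Cantor) : Prop :=
  ∃ e : ℕ × ℕ → Option (List Bool), ComputableFrom A e ∧
    ∀ m, G m = {X | ∃ s : ℕ, ∃ σ ∈ e (m, s), X ∈ cyl σ}

/-- The nonnegative reals `x m` are computable with oracle `A`, uniformly in `m`: from `m` and `k`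
one can compute a dyadic rational `a / 2^k` at distance at most `2^{-k}` from `x m`. -/
def IsUniformlyComputableRealIn (A : Cantor) (x : ℕ → ℝ) : Prop :=
  ∃ a : ℕ × ℕ → ℕ, ComputableFrom A a ∧
    ∀ m k : ℕ, |x m - (a (m, k) : ℝ) / 2 ^ k| ≤ (1 / 2 : ℝ) ^ k

/-- A Schnorr test relative to `A`: a uniformly `Σ⁰₁(A)` sequence whose `m`-th member has measure
at most `2^{-m}`, this measure being an `A`-computable real uniformly in `m`. -/
def IsSchnorrTestIn (A : Cantor) (G : ℕ → Set Cantor) : Prop :=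
  IsUniformlySigmaOneIn A G ∧
    (∀ m, coinMeasure (G m) ≤ (2⁻¹ : ENNReal) ^ m) ∧
    IsUniformlyComputableRealIn A fun m => (coinMeasure (G m)).toReal

/-- A set is Schnorr null relative to `A` if it is contained in the intersection of a Schnorr test
relative to `A`. -/
def IsSchnorrNullIn (A : Cantor) (N : Set Cantor) : Prop :=
  ∃ G : ℕ → Set Cantor, IsSchnorrTestIn A G ∧ N ⊆ ⋂ m, G m

/-- `A` is Schnorr-Kurtz engulfing: the union of all Kurtz null sets is Schnorr null relative
to `A`. -/
def IsSchnorrKurtzEngulfing (A : Cantor) : Prop :=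
  IsSchnorrNullIn A (⋃₀ {K | IsKurtzNull K})

end SchnorrKurtz

/-!
A function `f ≤_T A` that no computable function dominates can serve as a time bound: if the
program `e` computes a Kurtz test, its running time on suitable inputs is below `f` infinitely
often.  At stage `n`, run all programs `e ≤ n` for `f n` steps and collect the clopen sets they
output, discarding those that are too large for a Kurtz test.  The tails of this sequence of stages
have rapidly vanishing measure, so they form a Schnorr test relative to `A`, and it catches every
Kurtz null set.

Conversely, let `G` be the second member `G 1`, of measure at most `1 / 2`, of a Schnorr test
relative to `A` that covers all Kurtz null sets.  As the measure of `G` is `A`-computable, `A`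
computes clopen subsets of `G` that exhaust it up to the error `2 ^ (-(2 * n + 3))`.  The lengths
of the strings in these approximations, as a function of `n`, cannot be bounded by a computable
`i`: otherwise, let `Z n` be the set of sequences that vanish at `i 0 < … < i (n - 1)`.  Passing
from `Z n` to `Z (n + 1)` fixes a bit beyond the `n`-th approximation, which halves the measures of
`Z n` and, up to the error, of `G ∩ Z n`.  So `G` never covers `Z n`, and by compactness it omits a
point of the Kurtz null set `⋂ n, Z n`.
-/

namespace SchnorrKurtz

section OracleComputability

open Encodable

variable {α β γ σ : Type*} [Primcodable α] [Primcodable β] [Primcodable γ] [Primcodable σ]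
variable {O : Set (ℕ →. ℕ)}

theorem computableIn_empty_iff {f : α → σ} : ComputableIn ∅ f ↔ Computable f :=
  recursiveIn_empty_iff

theorem computableIn_comp {f : β → σ} {g : α → β} (hf : ComputableIn O f)
    (hg : ComputableIn O g) : ComputableIn O fun a => f (g a) :=
  (Nat.RecursiveIn.comp hf hg).of_eq fun n => by
    simp only [Part.map_some, Part.bind_eq_bind]
    cases decode (α := α) n <;> simp [encodek]

theorem computableIn_pair {f : α → β} {g : α → γ} (hf : ComputableIn O f)
    (hg : ComputableIn O g) : ComputableIn O fun a => (f a, g a) :=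
  (Nat.RecursiveIn.pair hf hg).of_eq fun n => by cases decode (α := α) n <;> simp [Seq.seq]

theorem computableIn_nat_rec {f : α → ℕ} {g : α → σ} {h : α × ℕ × σ → σ}
    (hf : ComputableIn O f) (hg : ComputableIn O g) (hh : ComputableIn O h) :
    ComputableIn O fun a =>
      Nat.rec (motive := fun _ => σ) (g a) (fun y IH => h (a, y, IH)) (f a) := by
  have hid : Nat.RecursiveIn O Part.some := RecursiveIn.iff_nat.1 .some
  refine ((Nat.RecursiveIn.prec hg hh).comp (hid.pair hf)).of_eq fun n => ?_
  rcases hn : decode (α := α) n with - | a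
  · simp [Seq.seq]
  · simp only [Seq.seq, Part.map_some, Part.coe_some, Part.bind_some, Part.bind_eq_bind,
      Part.map_eq_map, Nat.unpair_pair, encode_nat, hn]
    induction f a with
    | zero => rfl
    | succ k ih => dsimp only; rw [ih]; simp [hn, encodek]

theorem computableIn_list_map_range {f : α × ℕ → σ} (hf : ComputableIn O f) :
    ComputableIn O fun x : α × ℕ => (List.range x.2).map fun j => f (x.1, j) := by
  have hfst : ComputableIn O fun p : (α × ℕ) × ℕ × List σ => (p.1.1, p.2.1) :=
    (Primrec.pair (Primrec.fst.comp .fst) (Primrec.fst.comp .snd)).computableIn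
  have hsnd : ComputableIn O fun p : (α × ℕ) × ℕ × List σ => p.2.2 :=
    (Primrec.snd.comp .snd).computableIn
  have happend : ComputableIn O fun p : (α × ℕ) × ℕ × List σ => p.2.2 ++ [f (p.1.1, p.2.1)] :=
    computableIn_comp Primrec.list_concat.computableIn₂
      (computableIn_pair hsnd (computableIn_comp hf hfst))
  convert computableIn_nat_rec ComputableIn.snd (ComputableIn.const []) happend using 2 with x
  induction x.2 with
  | zero => rfl
  | succ n ih => simp only [List.range_succ, List.map_append, ih, List.map_cons, List.map_nil]

theorem exists_computableIn_search {p : α × ℕ → Bool} (hp : ComputableIn O p)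
    (H : ∀ a, ∃ n, p (a, n) = true) :
    ∃ s : α → ℕ, ComputableIn O s ∧ ∀ a, p (a, s a) = true := by
  have hq : ComputableIn O fun x => cond (p x) 0 1 :=
    computableIn_comp (Primrec.dom_bool fun b => cond b 0 1).computableIn hp
  refine ⟨fun a => Nat.find (H a), (Nat.RecursiveIn.rfind hq).of_eq fun n => ?_,
    fun a => Nat.find_spec (H a)⟩
  rcases hn : decode (α := α) n with - | a
  · simp only [Part.coe_none, Part.bind_none]
    exact Part.eq_none_iff.2 fun k hk => by simpa [hn] using Nat.rfind_spec hk
  · simp only [Part.coe_some, Part.bind_some, Part.map_some, encode_nat]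
    refine Part.eq_some_iff.2 (Nat.mem_rfind.2 ⟨?_, fun {m} hm => ?_⟩)
    · simp [hn, Nat.find_spec (H a)]
    · simp [hn, Nat.find_min (H a) hm]

end OracleComputability

/-! ### Strings and clopen sets -/

/-- The list of all binary strings of length `n`. -/
def strings : ℕ → List (List Bool)
  | 0 => [[]]
  | n + 1 => (strings n).map (false :: ·) ++ (strings n).map (true :: ·)

theorem mem_strings {n : ℕ} {τ : List Bool} : τ ∈ strings n ↔ τ.length = n := by
  induction n generalizing τ with
  | zero => simp [strings]
  | succ n ih => rcases τ with - | ⟨b, τ⟩ <;> [simp [strings]; cases b <;> simp [strings, ih]]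

theorem nodup_strings (n : ℕ) : (strings n).Nodup := by
  induction n with
  | zero => simp [strings]
  | succ n ih =>
    refine List.Nodup.append (ih.map List.cons_injective) (ih.map List.cons_injective) ?_
    simp [List.disjoint_left]

theorem primrec_strings : Primrec strings := by
  have hcons (b : Bool) : Primrec fun l : List (List Bool) => l.map (b :: ·) :=
    Primrec.list_map .id (Primrec.list_cons.comp (.const b) .snd).to₂
  refine (Primrec.nat_rec₁ [[]] (Primrec.list_append.comp
    ((hcons false).comp .snd) ((hcons true).comp .snd)).to₂).of_eq fun n => ?_
  induction n with
  | zero => rfl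
  | succ n ih => dsimp only; rw [ih]; rfl

/-- The initial segment of length `n` of `X`. -/
def initialSegment (X : Cantor) (n : ℕ) : List Bool := (List.range n).map X

@[simp]
theorem length_initialSegment (X : Cantor) (n : ℕ) : (initialSegment X n).length = n := by
  simp [initialSegment]

theorem getElem?_initialSegment (X : Cantor) {i n : ℕ} (h : i < n) :
    (initialSegment X n)[i]? = some (X i) := by
  simp [initialSegment, h]

theorem mem_cyl_iff_prefix {X : Cantor} {σ : List Bool} {n : ℕ} (h : σ.length ≤ n) :
    X ∈ cyl σ ↔ σ <+: initialSegment X n := by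
  simp only [cyl, Set.mem_ofPred_eq, List.prefix_iff_getElem, length_initialSegment, h,
    exists_true_left]
  simp [initialSegment, eq_comm]

theorem mem_cyl_iff_initialSegment_eq {X : Cantor} {σ : List Bool} {n : ℕ} (h : σ.length = n) :
    X ∈ cyl σ ↔ initialSegment X n = σ := by
  rw [mem_cyl_iff_prefix h.le]
  exact ⟨fun hσ => (hσ.eq_of_length (by simp [h])).symm, fun hσ => hσ ▸ List.prefix_rfl⟩

theorem isClopen_bit (i : ℕ) (b : Bool) : IsClopen {X : Cantor | X i = b} :=
  (isClopen_discrete {b}).preimage (continuous_apply i)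

theorem isClopen_cyl (σ : List Bool) : IsClopen (cyl σ) := by
  have : cyl σ = ⋂ i : Fin σ.length, {X : Cantor | X i = σ[i]} := by
    ext X
    simp [cyl, Fin.forall_iff]
  rw [this]
  exact isClopen_iInter_of_finite fun i => isClopen_bit _ _

theorem isClopen_clopen (D : List (List Bool)) : IsClopen (clopen D) :=
  D.finite_toSet.isClopen_biUnion fun σ _ => isClopen_cyl σ

theorem measurableSet_clopen (D : List (List Bool)) : MeasurableSet (clopen D) :=
  (isClopen_clopen D).isOpen.measurableSet

theorem mem_clopen {D : List (List Bool)} {X : Cantor} : X ∈ clopen D ↔ ∃ σ ∈ D, X ∈ cyl σ := by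
  simp [clopen]

theorem mem_clopen_flatMap {α : Type*} {l : List α} {F : α → List (List Bool)} {X : Cantor} :
    X ∈ clopen (l.flatMap F) ↔ ∃ a ∈ l, X ∈ clopen (F a) := by
  simp only [mem_clopen, List.mem_flatMap]
  tauto

theorem clopen_filter_strings (n : ℕ) (P : List Bool → Prop) [DecidablePred P] :
    clopen ((strings n).filter P) = {X | P (initialSegment X n)} := by
  ext X
  simp only [mem_clopen, List.mem_filter, mem_strings, decide_eq_true_iff, Set.mem_ofPred_eq]
  constructor
  · rintro ⟨σ, ⟨hlen, hσ⟩, hX⟩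
    rwa [(mem_cyl_iff_initialSegment_eq hlen).1 hX]
  · exact fun hX => ⟨_, ⟨length_initialSegment X n, hX⟩,
      (mem_cyl_iff_initialSegment_eq (length_initialSegment X n)).2 rfl⟩

/-- A bound for the lengths of the strings in `D`; crude, but visibly primitive recursive. -/
def level (D : List (List Bool)) : ℕ := D.flatten.length

theorem length_le_level {D : List (List Bool)} {σ : List Bool} (h : σ ∈ D) :
    σ.length ≤ level D :=
  (List.sublist_flatten_of_mem h).length_le

theorem primrec_level : Primrec level := Primrec.list_length.comp Primrec.list_flatten

theorem dependsOn_clopen (D : List (List Bool)) :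
    DependsOn (· ∈ clopen D) (Finset.range (level D) : Set ℕ) := by
  intro X Y h
  have hcyl : ∀ σ ∈ D, X ∈ cyl σ ↔ Y ∈ cyl σ := fun σ hσ =>
    forall₂_congr fun i hi => by
      rw [h i (by simpa using hi.trans_le (length_le_level hσ))]
  simp only [mem_clopen]
  exact propext (exists_congr fun σ => and_congr_right (hcyl σ))

/-- The strings of length `level D` that extend a string in `D`: an index for the same clopen set
all of whose cylinders are disjoint and of equal measure. -/
def refinement (D : List (List Bool)) : List (List Bool) :=
  (strings (level D)).filter fun τ => ∃ σ ∈ D, σ <+: τ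

theorem clopen_refinement (D : List (List Bool)) : clopen (refinement D) = clopen D := by
  rw [refinement, clopen_filter_strings]
  ext X
  exact (mem_clopen.trans (exists_congr fun σ => and_congr_right fun hσ =>
    mem_cyl_iff_prefix (length_le_level hσ))).symm

theorem primrec_refinement : Primrec refinement := by
  have hprefix : PrimrecRel fun σ τ : List Bool => σ <+: τ :=
    (Primrec.eq.comp .fst (Primrec.list_take.comp (Primrec.list_length.comp .fst) .snd)).of_eq
      fun _ => List.prefix_iff_eq_take.symm
  exact hprefix.exists_mem_list.swap.listFilter.comp (primrec_strings.comp primrec_level) .id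

/-! ### The coin-tossing measure -/

section Measure

variable {α : Type*} [MeasurableSpace α] {μ : Measure α}

theorem measure_le_inv_two_pow_iff [IsFiniteMeasure μ] {s : Set α} {k : ℕ} :
    μ s ≤ (2⁻¹ : ENNReal) ^ k ↔ μ.real s ≤ (1 / 2 : ℝ) ^ k := by
  rw [← ENNReal.toReal_le_toReal (measure_ne_top _ _) (by simp)]
  simp [ENNReal.toReal_pow, Measure.real]

theorem measure_iUnion_le_inv_two_pow {U : ℕ → Set α} {k : ℕ}
    (h : ∀ j, μ (U j) ≤ (2⁻¹ : ENNReal) ^ (k + j + 1)) :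
    μ (⋃ j, U j) ≤ (2⁻¹ : ENNReal) ^ k := by
  refine (measure_iUnion_le U).trans ((ENNReal.tsum_le_tsum h).trans_eq ?_)
  simp_rw [pow_add, mul_assoc, ENNReal.tsum_mul_left, ENNReal.tsum_mul_right,
    ENNReal.tsum_geometric, ENNReal.one_sub_inv_two, inv_inv, pow_one]
  rw [ENNReal.mul_inv_cancel (by simp) (by simp), mul_one]

theorem infinitePi_inter_of_dependsOn {ι : Type*} {Ω : ι → Type*} [∀ i, MeasurableSpace (Ω i)]
    [∀ i, Countable (Ω i)] [∀ i, MeasurableSingletonClass (Ω i)] (P : ∀ i, Measure (Ω i))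
    [∀ i, IsProbabilityMeasure (P i)] {S T : Finset ι} (hST : Disjoint S T)
    {B C : Set (∀ i, Ω i)} (hB : DependsOn (· ∈ B) (S : Set ι))
    (hC : DependsOn (· ∈ C) (T : Set ι)) :
    Measure.infinitePi P (B ∩ C) = Measure.infinitePi P B * Measure.infinitePi P C := by
  have hpre {R : Finset ι} {E : Set (∀ i, Ω i)} (hE : DependsOn (· ∈ E) (R : Set ι)) :
      R.restrict ⁻¹' (R.restrict '' E) = E := by
    refine Set.Subset.antisymm (fun X ⟨Y, hY, hYX⟩ => ?_) (Set.subset_preimage_image _ _)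
    exact (hE fun i hi => congrFun hYX ⟨i, hi⟩).mp hY
  have hind : ProbabilityTheory.IndepFun (S.restrict (π := Ω)) (T.restrict (π := Ω))
      (Measure.infinitePi P) := (ProbabilityTheory.iIndepFun_infinitePi (P := P) (X := fun _ => id)
    fun _ => measurable_id).indepFun_finset S T hST fun i => measurable_pi_apply i
  have h := hind.measure_inter_preimage_eq_mul (S.restrict '' B) (T.restrict '' C)
    (Set.to_countable _).measurableSet
    (Set.to_countable _).measurableSet
  rwa [hpre hB, hpre hC] at h

end Measure

instance : IsProbabilityMeasure coinMeasure := by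
  unfold coinMeasure; infer_instance

theorem coinMeasure_real_pi_singleton (S : Finset ℕ) (x : Cantor) :
    coinMeasure.real (Set.pi S fun i => {x i}) = (1 / 2 : ℝ) ^ S.card := by
  rw [Measure.real, coinMeasure, Measure.infinitePi_pi _ fun _ _ => measurableSet_singleton _]
  simp

theorem coinMeasure_real_cyl (σ : List Bool) :
    coinMeasure.real (cyl σ) = (1 / 2 : ℝ) ^ σ.length := by
  have : cyl σ = Set.pi (Finset.range σ.length) fun i => {σ.getD i false} := by
    ext X
    simp only [cyl, Set.mem_ofPred_eq, Set.mem_pi, Finset.coe_range, Set.mem_Iio,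
      Set.mem_singleton_iff]
    exact forall₂_congr fun i hi => by rw [List.getD_eq_getElem _ _ hi]
  rw [this, coinMeasure_real_pi_singleton, Finset.card_range]

theorem coinMeasure_real_inter_bit {S : Finset ℕ} {B : Set Cantor}
    (hB : DependsOn (· ∈ B) (S : Set ℕ)) {n : ℕ} (hn : n ∉ S) (b : Bool) :
    coinMeasure.real (B ∩ {X | X n = b}) = coinMeasure.real B / 2 := by
  have hbit : coinMeasure.real {X | X n = b} = 1 / 2 := by
    simpa [Set.pi] using coinMeasure_real_pi_singleton {n} fun _ => b
  have hdep : DependsOn (· ∈ {X : Cantor | X n = b}) (({n} : Finset ℕ) : Set ℕ) :=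
    fun X Y h => by simp [h n (by simp)]
  have hmul : coinMeasure (B ∩ {X | X n = b}) = coinMeasure B * coinMeasure {X | X n = b} :=
    infinitePi_inter_of_dependsOn _ (Finset.disjoint_singleton_right.2 hn) hB hdep
  rw [measureReal_def, hmul, ENNReal.toReal_mul, ← measureReal_def, ← measureReal_def, hbit,
    mul_one_div]

theorem coinMeasure_real_clopen_of_length_eq {D : List (List Bool)} {n : ℕ} (hD : D.Nodup)
    (hlen : ∀ σ ∈ D, σ.length = n) : coinMeasure.real (clopen D) = D.length / 2 ^ n := by
  have hdisj : (D.toFinset : Set (List Bool)).PairwiseDisjoint cyl := by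
    intro σ hσ τ hτ hne
    refine Set.disjoint_left.2 fun X hXσ hXτ => hne ?_
    rw [mem_cyl_iff_initialSegment_eq (hlen _ (by simpa using hσ))] at hXσ
    rw [mem_cyl_iff_initialSegment_eq (hlen _ (by simpa using hτ))] at hXτ
    exact hXσ.symm.trans hXτ
  have hunion : clopen D = ⋃ σ ∈ D.toFinset, cyl σ := by simp [clopen]
  rw [hunion, measureReal_biUnion_finset hdisj fun σ _ => (isClopen_cyl σ).isOpen.measurableSet,
    Finset.sum_congr rfl fun σ hσ => by rw [coinMeasure_real_cyl, hlen σ (by simpa using hσ)],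
    Finset.sum_const, List.toFinset_card_of_nodup hD]
  simp [div_eq_mul_inv]

/-- The measure of `clopen D`, rounded down to the numerator of a fraction with denominator
`2 ^ k`. -/
noncomputable def measureFloor (D : List (List Bool)) (k : ℕ) : ℕ :=
  ⌊coinMeasure.real (clopen D) * 2 ^ k⌋₊

theorem measureFloor_eq (D : List (List Bool)) (k : ℕ) :
    measureFloor D k = (refinement D).length * 2 ^ k / 2 ^ level D := by
  have h : coinMeasure.real (clopen D) = (refinement D).length / 2 ^ level D := by
    rw [← clopen_refinement, coinMeasure_real_clopen_of_length_eq (D := refinement D)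
      ((nodup_strings _).filter _) fun σ hσ => mem_strings.1 (List.mem_of_mem_filter hσ)]
  rw [measureFloor, h, div_mul_eq_mul_div, ← Nat.floor_div_eq_div (K := ℝ)]
  push_cast
  rfl

theorem primrec₂_pow : Primrec₂ fun a b : ℕ => a ^ b := Primrec₂.unpaired'.1 Nat.Primrec.pow

theorem primrec₂_measureFloor : Primrec₂ measureFloor :=
  (Primrec.nat_div.comp
    (Primrec.nat_mul.comp (Primrec.list_length.comp (primrec_refinement.comp .fst))
      (primrec₂_pow.comp (.const 2) .snd))
    (primrec₂_pow.comp (.const 2) (primrec_level.comp .fst))).of_eq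
    fun x => (measureFloor_eq x.1 x.2).symm

theorem measureFloor_div_le (D : List (List Bool)) (k : ℕ) :
    (measureFloor D k : ℝ) / 2 ^ k ≤ coinMeasure.real (clopen D) :=
  (div_le_iff₀ (by positivity)).2 (Nat.floor_le (by positivity))

theorem lt_measureFloor_add_one_div (D : List (List Bool)) (k : ℕ) :
    coinMeasure.real (clopen D) < (measureFloor D k + 1) / 2 ^ k :=
  (lt_div_iff₀ (by positivity)).2 (Nat.lt_floor_add_one _)

/-! ### Schnorr tests -/

section SchnorrTests

variable {A : Cantor} {G : ℕ → Set Cantor}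

theorem isUniformlySigmaOneIn_iUnion_clopen {v : ℕ × ℕ → List (List Bool)}
    (hv : ComputableFrom A v) : IsUniformlySigmaOneIn A fun m => ⋃ j, clopen (v (m, j)) := by
  refine ⟨fun x => (v (x.1, x.2.unpair.1))[x.2.unpair.2]?, ?_, fun m => ?_⟩
  · have hindex : Primrec fun x : ℕ × ℕ => (x.1, x.2.unpair.1) :=
      Primrec.pair .fst (Primrec.fst.comp (Primrec.unpair.comp .snd))
    have hposition : Primrec fun x : ℕ × ℕ => x.2.unpair.2 :=
      Primrec.snd.comp (Primrec.unpair.comp .snd)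
    exact computableIn_comp Primrec.list_getElem?.computableIn₂
      (computableIn_pair (computableIn_comp hv hindex.computableIn) hposition.computableIn)
  · ext X
    simp only [Set.mem_iUnion, mem_clopen, Set.mem_ofPred_eq, Option.mem_def]
    constructor
    · rintro ⟨j, σ, hσ, hX⟩
      obtain ⟨l, hl⟩ := List.mem_iff_getElem?.1 hσ
      exact ⟨Nat.pair j l, σ, by simpa using hl, hX⟩
    · rintro ⟨s, σ, hσ, hX⟩
      exact ⟨s.unpair.1, σ, List.mem_of_getElem? hσ, hX⟩

theorem isUniformlyComputableRealIn_of_clopen_approx {W : ℕ × ℕ → List (List Bool)} {x : ℕ → ℝ}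
    (hW : ComputableFrom A W) (hle : ∀ m k, coinMeasure.real (clopen (W (m, k))) ≤ x m)
    (hge : ∀ m k, x m ≤ coinMeasure.real (clopen (W (m, k))) + (1 / 2 : ℝ) ^ k) :
    IsUniformlyComputableRealIn A x := by
  refine ⟨fun y => measureFloor (W y) y.2 + 1, ?_, fun m k => ?_⟩
  · have hfloor : Primrec fun z : List (List Bool) × ℕ => measureFloor z.1 z.2 + 1 :=
      Primrec.succ.comp primrec₂_measureFloor
    exact (computableIn_comp hfloor.computableIn (computableIn_pair hW .snd) :)
  · have hlower := measureFloor_div_le (W (m, k)) k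
    have hupper := lt_measureFloor_add_one_div (W (m, k)) k
    have hsplit : ((measureFloor (W (m, k)) k : ℝ) + 1) / 2 ^ k =
        measureFloor (W (m, k)) k / 2 ^ k + (1 / 2) ^ k := by
      rw [add_div, one_div_pow]
    push_cast
    rw [abs_le]
    constructor <;> linarith [hle m k, hge m k]

theorem isSchnorrTestIn_iUnion_clopen {v : ℕ × ℕ → List (List Bool)} (hv : ComputableFrom A v)
    (hμ : ∀ m j, coinMeasure (clopen (v (m, j))) ≤ (2⁻¹ : ENNReal) ^ (m + j + 1)) :
    IsSchnorrTestIn A fun m => ⋃ j, clopen (v (m, j)) := by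
  let W : ℕ × ℕ → List (List Bool) := fun x => (List.range x.2).flatMap fun j => v (x.1, j)
  have hW : ComputableFrom A W :=
    computableIn_comp Primrec.list_flatten.computableIn (computableIn_list_map_range hv)
  have htail : ∀ m k, coinMeasure.real (⋃ j, clopen (v (m, k + j))) ≤ (1 / 2) ^ k := by
    intro m k
    refine measure_le_inv_two_pow_iff.1 (measure_iUnion_le_inv_two_pow fun j => ?_)
    exact (hμ m (k + j)).trans
      (pow_le_pow_right_of_le_one' (ENNReal.inv_le_one.2 one_le_two) (by lia))
  refine ⟨isUniformlySigmaOneIn_iUnion_clopen hv, fun m => measure_iUnion_le_inv_two_pow (hμ m),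
    isUniformlyComputableRealIn_of_clopen_approx hW (fun m k => measureReal_mono ?_) fun m k => ?_⟩
  · intro X hX
    obtain ⟨j, -, hj⟩ := mem_clopen_flatMap.1 hX
    exact Set.mem_iUnion.2 ⟨j, hj⟩
  · have hsub : ⋃ j, clopen (v (m, j)) ⊆ clopen (W (m, k)) ∪ ⋃ j, clopen (v (m, k + j)) := by
      refine Set.iUnion_subset fun j X hj => ?_
      rcases lt_or_ge j k with h | h
      · exact .inl (mem_clopen_flatMap.2 ⟨j, List.mem_range.2 h, hj⟩)
      · obtain ⟨i, rfl⟩ := Nat.exists_eq_add_of_le h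
        exact .inr (Set.mem_iUnion.2 ⟨i, hj⟩)
    calc coinMeasure.real (⋃ j, clopen (v (m, j)))
        ≤ coinMeasure.real (clopen (W (m, k)) ∪ ⋃ j, clopen (v (m, k + j))) :=
          measureReal_mono hsub
      _ ≤ coinMeasure.real (clopen (W (m, k))) + coinMeasure.real (⋃ j, clopen (v (m, k + j))) :=
          measureReal_union_le _ _
      _ ≤ coinMeasure.real (clopen (W (m, k))) + (1 / 2) ^ k := by grw [htail m k]

theorem IsUniformlySigmaOneIn.exists_monotone_clopen (hG : IsUniformlySigmaOneIn A G) :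
    ∃ S : ℕ × ℕ → List (List Bool), ComputableFrom A S ∧
      ∀ m, (Monotone fun s => clopen (S (m, s))) ∧ ⋃ s, clopen (S (m, s)) = G m := by
  obtain ⟨e, he, hGe⟩ := hG
  let S : ℕ × ℕ → List (List Bool) := fun x =>
    ((List.range x.2).map fun t => e (x.1, t)).reduceOption
  have hS : ComputableFrom A S :=
    computableIn_comp (Primrec.listFilterMap .id Primrec.snd.to₂).computableIn
      (computableIn_list_map_range he)
  have hmem : ∀ m s X, X ∈ clopen (S (m, s)) ↔ ∃ t < s, ∃ σ ∈ e (m, t), X ∈ cyl σ := by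
    intro m s X
    simp only [S, mem_clopen, List.reduceOption_mem_iff, List.mem_map, List.mem_range,
      Option.mem_def]
    tauto
  refine ⟨S, hS, fun m => ⟨fun s t hst X hX => ?_, ?_⟩⟩
  · obtain ⟨u, hu, hσ⟩ := (hmem m s X).1 hX
    exact (hmem m t X).2 ⟨u, hu.trans_le hst, hσ⟩
  · ext X
    simp only [Set.mem_iUnion, hmem, hGe, Set.mem_ofPred_eq]
    exact ⟨fun ⟨_, t, _, h⟩ => ⟨t, h⟩, fun ⟨t, h⟩ => ⟨t + 1, t, t.lt_succ_self, h⟩⟩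

theorem IsUniformlySigmaOneIn.isOpen (hG : IsUniformlySigmaOneIn A G) (m : ℕ) : IsOpen (G m) := by
  obtain ⟨S, -, hS⟩ := hG.exists_monotone_clopen
  rw [← (hS m).2]
  exact isOpen_iUnion fun s => (isClopen_clopen _).isOpen

theorem exists_lt_measureFloor_add {S : ℕ → List (List Bool)} (hS : Monotone fun s => clopen (S s))
    {a k : ℕ} (ha : |coinMeasure.real (⋃ s, clopen (S s)) - a / 2 ^ k| ≤ (1 / 2 : ℝ) ^ k) :
    ∃ s, a ≤ measureFloor (S s) k + 2 := by
  have hlim : Tendsto (fun s => coinMeasure.real (clopen (S s))) atTop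
      (nhds (coinMeasure.real (⋃ s, clopen (S s)))) :=
    (ENNReal.tendsto_toReal (measure_ne_top _ _)).comp (tendsto_measure_iUnion_atTop hS)
  obtain ⟨s, hs⟩ := (hlim.eventually (lt_mem_nhds (sub_lt_self _ (by positivity :
    (0 : ℝ) < (1 / 2) ^ k)))).exists
  have hfloor := lt_measureFloor_add_one_div (S s) k
  have hlt : (a : ℝ) / 2 ^ k < (measureFloor (S s) k + 3) / 2 ^ k := by
    have hsplit : ((measureFloor (S s) k : ℝ) + 3) / 2 ^ k =
        (measureFloor (S s) k + 1) / 2 ^ k + 2 * (1 / 2) ^ k := by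
      rw [one_div_pow]; ring
    linarith [abs_le.1 ha]
  have := (div_lt_div_iff_of_pos_right (by positivity)).1 hlt
  refine ⟨s, Nat.lt_succ_iff.1 ?_⟩
  exact_mod_cast this

theorem sub_measureReal_le_of_le_measureFloor_add {D : List (List Bool)} {a k : ℕ} {x : ℝ}
    (hx : |x - a / 2 ^ (k + 2)| ≤ (1 / 2 : ℝ) ^ (k + 2))
    (ha : a ≤ measureFloor D (k + 2) + 2) : x - coinMeasure.real (clopen D) ≤ (1 / 2 : ℝ) ^ k := by
  have hfloor := measureFloor_div_le D (k + 2)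
  have hle : (a : ℝ) / 2 ^ (k + 2) ≤ (measureFloor D (k + 2) + 2) / 2 ^ (k + 2) := by
    gcongr
    exact_mod_cast ha
  have hsplit : ((measureFloor D (k + 2) : ℝ) + 2) / 2 ^ (k + 2) =
      measureFloor D (k + 2) / 2 ^ (k + 2) + 2 * (1 / 2) ^ (k + 2) := by
    rw [one_div_pow]; ring
  have hpow : (1 / 2 : ℝ) ^ k = 4 * (1 / 2) ^ (k + 2) := by ring
  have : (0 : ℝ) < (1 / 2) ^ (k + 2) := by positivity
  linarith [abs_le.1 hx]

theorem IsSchnorrTestIn.exists_clopen_approx (hG : IsSchnorrTestIn A G) :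
    ∃ D : ℕ × ℕ → List (List Bool), ComputableFrom A D ∧ ∀ m k, clopen (D (m, k)) ⊆ G m ∧
      coinMeasure.real (G m \ clopen (D (m, k))) ≤ (1 / 2 : ℝ) ^ k := by
  obtain ⟨hsigma, -, a, ha, hGa⟩ := hG
  obtain ⟨S, hS, hSG⟩ := hsigma.exists_monotone_clopen
  -- In units of `2 ^ (-(k + 2))`: all but finitely many stages satisfy this test, and any stage
  -- that does is off by at most 3 units, hence by less than `2 ^ (-k)`.
  let p : (ℕ × ℕ) × ℕ → Bool := fun x =>
    decide (a (x.1.1, x.1.2 + 2) ≤ measureFloor (S (x.1.1, x.2)) (x.1.2 + 2) + 2)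
  have hp : ComputableFrom A p := by
    have htest : Primrec fun z : ℕ × List (List Bool) × ℕ =>
        decide (z.1 ≤ measureFloor z.2.1 z.2.2 + 2) :=
      (Primrec.nat_le.comp .fst (Primrec.nat_add.comp
        (primrec₂_measureFloor.comp (Primrec.fst.comp .snd) (Primrec.snd.comp .snd))
        (.const 2))).decide
    have hstage : Primrec fun x : (ℕ × ℕ) × ℕ => (x.1.1, x.2) :=
      Primrec.pair (Primrec.fst.comp .fst) .snd
    have hprec : Primrec fun x : (ℕ × ℕ) × ℕ => x.1.2 + 2 :=
      Primrec.nat_add.comp (Primrec.snd.comp .fst) (.const 2)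
    have hindex : Primrec fun x : (ℕ × ℕ) × ℕ => (x.1.1, x.1.2 + 2) :=
      Primrec.pair (Primrec.fst.comp .fst) hprec
    exact computableIn_comp htest.computableIn
      (computableIn_pair (computableIn_comp ha hindex.computableIn)
        (computableIn_pair (computableIn_comp hS hstage.computableIn) hprec.computableIn))
  obtain ⟨s, hs, hps⟩ := exists_computableIn_search hp fun x =>
    (exists_lt_measureFloor_add (hSG x.1).1 (a := a (x.1, x.2 + 2))
      (by rw [(hSG x.1).2]; exact hGa _ _)).imp fun s hs => decide_eq_true hs
  have hsub : ∀ m t, clopen (S (m, t)) ⊆ G m := fun m t =>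
    (Set.subset_iUnion _ t).trans_eq (hSG m).2
  refine ⟨fun x => S (x.1, s x), computableIn_comp hS (computableIn_pair .fst hs),
    fun m k => ⟨hsub m _, ?_⟩⟩
  rw [measureReal_sdiff (hsub m _) (measurableSet_clopen _)]
  exact sub_measureReal_le_of_le_measureFloor_add (hGa m _) (of_decide_eq_true (hps (m, k)))

end SchnorrTests

/-! ### Schnorr-Kurtz engulfing oracles have hyperimmune degree -/

/-- The closed set of the sequences that vanish at the positions `i 0, …, i (n - 1)`. -/
def zerosAt (i : ℕ → ℕ) (n : ℕ) : Set Cantor := {X | ∀ j < n, X (i j) = false}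

theorem zerosAt_zero (i : ℕ → ℕ) : zerosAt i 0 = Set.univ := by
  ext; simp [zerosAt]

theorem zerosAt_succ (i : ℕ → ℕ) (n : ℕ) :
    zerosAt i (n + 1) = zerosAt i n ∩ {X | X (i n) = false} := by
  ext X
  simp only [zerosAt, Set.mem_ofPred_eq, Set.mem_inter_iff, Nat.forall_lt_succ_right]

theorem isClosed_zerosAt (i : ℕ → ℕ) (n : ℕ) : IsClosed (zerosAt i n) := by
  induction n with
  | zero => rw [zerosAt_zero]; exact isClosed_univ
  | succ n ih => rw [zerosAt_succ]; exact ih.inter (isClopen_bit _ _).isClosed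

theorem dependsOn_zerosAt {i : ℕ → ℕ} (hi : StrictMono i) (n : ℕ) :
    DependsOn (· ∈ zerosAt i n) (Finset.range (i n) : Set ℕ) := fun X Y h =>
  propext (forall₂_congr fun j hj => by rw [h (i j) (by simpa using hi hj)])

theorem coinMeasure_real_zerosAt {i : ℕ → ℕ} (hi : i.Injective) (n : ℕ) :
    coinMeasure.real (zerosAt i n) = (1 / 2 : ℝ) ^ n := by
  have : zerosAt i n = Set.pi ((Finset.range n).image i) fun _ => {false} := by
    ext X
    simp [zerosAt]
  rw [this, coinMeasure_real_pi_singleton _ fun _ => false, Finset.card_image_of_injective _ hi,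
    Finset.card_range]

theorem exists_computable_zerosAt_eq_clopen {i : ℕ → ℕ} (hi : StrictMono i) (hc : Computable i) :
    ∃ D : ℕ → List (List Bool), Computable D ∧ ∀ n, zerosAt i n = clopen (D n) := by
  let Z : List Bool → List ℕ → Prop := fun τ l => ∀ x ∈ l, τ[x]? = some false
  have : DecidableRel Z := fun τ l => by unfold Z; infer_instance
  have hZ : PrimrecRel Z := by
    have h : PrimrecRel fun (x : ℕ) (τ : List Bool) => τ[x]? = some false :=
      Primrec.eq.comp (Primrec.list_getElem?.comp .snd .fst) (.const _)
    exact h.forall_mem_list.swap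
  have hpositions : Computable fun n => (List.range n).map i :=
    computableIn_empty_iff.1 (computableIn_comp
      (computableIn_list_map_range (f := fun x : ℕ × ℕ => i x.2) (hc.comp .snd).computableIn)
      (computableIn_pair .id .id) :)
  refine ⟨fun n => (strings (i n)).filter (Z · ((List.range n).map i)),
    hZ.listFilter.to_comp.comp (primrec_strings.to_comp.comp hc) hpositions, fun n => ?_⟩
  rw [clopen_filter_strings]
  ext X
  simp only [zerosAt, Z, Set.mem_ofPred_eq, List.mem_map, List.mem_range, forall_exists_index,
    and_imp, forall_apply_eq_imp_iff₂]
  exact forall₂_congr fun j hj => by simp [getElem?_initialSegment X (hi hj)]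

theorem isKurtzNull_iInter_zerosAt {i : ℕ → ℕ} (hi : StrictMono i) (hc : Computable i) :
    IsKurtzNull (⋂ n, zerosAt i n) :=
  ⟨zerosAt i, ⟨exists_computable_zerosAt_eq_clopen hi hc, fun n =>
    measure_le_inv_two_pow_iff.2 (coinMeasure_real_zerosAt hi.injective n).le⟩, rfl⟩

section Escape

variable {G : Set Cantor} {i : ℕ → ℕ} (hi : StrictMono i)
include hi

theorem coinMeasure_real_inter_zerosAt_succ_le {D : List (List Bool)} (hDG : clopen D ⊆ G)
    {n : ℕ} (hD : level D ≤ i n) :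
    coinMeasure.real (G ∩ zerosAt i (n + 1)) ≤
      coinMeasure.real (G ∩ zerosAt i n) / 2 + coinMeasure.real (G \ clopen D) := by
  have hsub : G ∩ zerosAt i (n + 1) ⊆
      ((clopen D ∩ zerosAt i n) ∩ {X | X (i n) = false}) ∪ (G \ clopen D) := by
    rw [zerosAt_succ]
    tauto_set
  have hdep : DependsOn (· ∈ clopen D ∩ zerosAt i n) (Finset.range (i n) : Set ℕ) := by
    intro X Y h
    have hrange : ∀ j ∈ (Finset.range (level D) : Set ℕ), X j = Y j := fun j hj =>
      h j (Finset.range_mono hD hj)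
    exact congrArg₂ And (dependsOn_clopen D hrange) (dependsOn_zerosAt hi n h)
  calc coinMeasure.real (G ∩ zerosAt i (n + 1))
      ≤ coinMeasure.real ((clopen D ∩ zerosAt i n) ∩ {X | X (i n) = false}) +
          coinMeasure.real (G \ clopen D) :=
        (measureReal_mono hsub).trans (measureReal_union_le _ _)
    _ = coinMeasure.real (clopen D ∩ zerosAt i n) / 2 + coinMeasure.real (G \ clopen D) := by
        rw [coinMeasure_real_inter_bit hdep Finset.notMem_range_self]
    _ ≤ coinMeasure.real (G ∩ zerosAt i n) / 2 + coinMeasure.real (G \ clopen D) := by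
        gcongr
        finiteness

variable {D : ℕ → List (List Bool)} (hμ : coinMeasure.real G ≤ 1 / 2)
  (hD : ∀ n, clopen (D n) ⊆ G ∧ coinMeasure.real (G \ clopen (D n)) ≤ (1 / 2 : ℝ) ^ (2 * n + 3))
  (hDi : ∀ n, level (D n) ≤ i n)
include hμ hD hDi

theorem coinMeasure_real_inter_zerosAt_le (n : ℕ) :
    coinMeasure.real (G ∩ zerosAt i n) ≤ (1 / 2 : ℝ) ^ n * (1 - (1 / 2) ^ (n + 1)) := by
  induction n with
  | zero =>
    rw [zerosAt_zero, Set.inter_univ]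
    linarith
  | succ n ih =>
    calc coinMeasure.real (G ∩ zerosAt i (n + 1))
        ≤ coinMeasure.real (G ∩ zerosAt i n) / 2 + coinMeasure.real (G \ clopen (D n)) :=
          coinMeasure_real_inter_zerosAt_succ_le hi (hD n).1 (hDi n)
      _ ≤ (1 / 2) ^ n * (1 - (1 / 2) ^ (n + 1)) / 2 + (1 / 2) ^ (2 * n + 3) := by
          gcongr
          exact (hD n).2
      _ = (1 / 2) ^ (n + 1) * (1 - (1 / 2) ^ (n + 1 + 1)) := by ring

theorem exists_mem_iInter_zerosAt_notMem (hG : IsOpen G) : ∃ X ∈ ⋂ n, zerosAt i n, X ∉ G := by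
  have hnonempty : ∀ n, (zerosAt i n ∩ Gᶜ).Nonempty := by
    intro n
    rw [Set.inter_compl_nonempty_iff]
    intro hsub
    have h := coinMeasure_real_inter_zerosAt_le hi hμ hD hDi n
    rw [Set.inter_eq_right.2 hsub, coinMeasure_real_zerosAt hi.injective] at h
    have : (0 : ℝ) < (1 / 2) ^ n * (1 / 2) ^ (n + 1) := by positivity
    linarith
  have hclosed : ∀ n, IsClosed (zerosAt i n ∩ Gᶜ) := fun n =>
    (isClosed_zerosAt i n).inter hG.isClosed_compl
  have hanti : ∀ n, zerosAt i (n + 1) ∩ Gᶜ ⊆ zerosAt i n ∩ Gᶜ := fun n =>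
    Set.inter_subset_inter_left _ (zerosAt_succ i n ▸ Set.inter_subset_left)
  obtain ⟨X, hX⟩ := IsCompact.nonempty_iInter_of_sequence_nonempty_isCompact_isClosed _
    hanti hnonempty (hclosed 0).isCompact hclosed
  rw [Set.mem_iInter] at hX
  exact ⟨X, Set.mem_iInter.2 fun n => (hX n).1, (hX 0).2⟩

end Escape

theorem exists_computable_strictMono_ge {g : ℕ → ℕ} (hg : Computable g) :
    ∃ i : ℕ → ℕ, Computable i ∧ StrictMono i ∧ ∀ n, g n ≤ i n := by
  let s : ℕ → ℕ := fun n => Nat.rec (motive := fun _ => ℕ) 0 (fun y r => r + g y + 1) n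
  have hs : Computable s :=
    Computable.nat_rec .id (.const 0) (Primrec.succ.to_comp.comp (Primrec.nat_add.to_comp.comp
      (Computable.snd.comp .snd) (hg.comp (Computable.fst.comp .snd)))).to₂
  have hstep : ∀ n, s (n + 1) = s n + g n + 1 := fun n => rfl
  refine ⟨fun n => s (n + 1), hs.comp .succ, strictMono_nat_of_lt_succ fun n => ?_, fun n => ?_⟩
  · rw [hstep (n + 1)]; lia
  · change g n ≤ s (n + 1)
    lia

theorem exists_computable_ge_of_eventually_le {f g : ℕ → ℕ} (hg : Computable g)
    (h : ∀ᶠ n in atTop, f n ≤ g n) : ∃ g' : ℕ → ℕ, Computable g' ∧ ∀ n, f n ≤ g' n := by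
  obtain ⟨N, hN⟩ := eventually_atTop.1 h
  refine ⟨fun n => g n + ∑ j ∈ Finset.range N, f j,
    Primrec.nat_add.to_comp.comp hg (.const _), fun n => ?_⟩
  rcases lt_or_ge n N with hn | hn
  · exact (Finset.single_le_sum (f := f) (fun _ _ => Nat.zero_le _)
      (Finset.mem_range.2 hn)).trans (Nat.le_add_left _ _)
  · exact (hN n hn).trans (Nat.le_add_right _ _)

theorem IsSchnorrKurtzEngulfing.isOfHyperimmuneDegree {A : Cantor}
    (hA : IsSchnorrKurtzEngulfing A) : IsOfHyperimmuneDegree A := by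
  obtain ⟨G, hG, hsub⟩ := hA
  obtain ⟨D, hDc, hD⟩ := hG.exists_clopen_approx
  have hindex : Primrec fun n : ℕ => (1, 2 * n + 3) :=
    Primrec.pair (.const 1) (Primrec.nat_add.comp (Primrec.nat_mul.comp (.const 2) .id) (.const 3))
  refine ⟨fun n => level (D (1, 2 * n + 3)), computableIn_comp primrec_level.computableIn
    (computableIn_comp hDc hindex.computableIn), fun g hg hle => ?_⟩
  obtain ⟨g', hg', hle'⟩ := exists_computable_ge_of_eventually_le hg hle
  obtain ⟨i, hic, hi, hgi⟩ := exists_computable_strictMono_ge hg'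
  have hμ : coinMeasure.real (G 1) ≤ 1 / 2 := by
    simpa only [pow_one] using measure_le_inv_two_pow_iff.1 (hG.2.1 1)
  obtain ⟨X, hX, hXG⟩ := exists_mem_iInter_zerosAt_notMem hi hμ (fun n => hD 1 (2 * n + 3))
    (fun n => (hle' n).trans (hgi n)) (hG.1.isOpen 1)
  exact hXG (Set.mem_iInter.1 (hsub ⟨_, isKurtzNull_iInter_zerosAt hi hic, hX⟩) 1)

/-! ### Oracles of hyperimmune degree are Schnorr-Kurtz engulfing -/

open Nat.Partrec (Code)

section RunFor

variable (β : Type*) [Primcodable β] [Inhabited β]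

/-- The output, decoded as an element of `β`, of the program with number `e` on input `n` with
time bound `t`; a program that has not halted outputs `default`. -/
def runFor (t e n : ℕ) : β :=
  ((Code.evaln t (Denumerable.ofNat Code e) n).bind Encodable.decode).getD default

theorem primrec_runFor : Primrec fun x : ℕ × ℕ × ℕ => runFor β x.1 x.2.1 x.2.2 :=
  Primrec.option_getD.comp (Primrec.option_bind
    (Code.primrec_evaln.comp (Primrec.pair (Primrec.pair .fst
      ((Primrec.ofNat Code).comp (Primrec.fst.comp .snd))) (Primrec.snd.comp .snd)))
    (Primrec.decode.comp .snd).to₂) (.const default)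

variable {β}

theorem exists_runFor_eq {D : ℕ → β} (hD : Computable D) :
    ∃ e : ℕ, ∃ g : ℕ → ℕ, Computable g ∧ ∀ n t, g n ≤ t → runFor β t e n = D n := by
  obtain ⟨c, hc⟩ := Code.exists_code.1 hD
  have heval : ∀ n, Encodable.encode (D n) ∈ c.eval n := fun n => by rw [hc]; simp
  have hhalts : Computable fun x : ℕ × ℕ => (Code.evaln x.2 c x.1).isSome :=
    (Primrec.option_isSome.comp (Code.primrec_evaln.comp
      (Primrec.pair (Primrec.pair .snd (.const c)) .fst))).to_comp
  obtain ⟨g, hg, hgspec⟩ := exists_computableIn_search (O := ∅) hhalts.computableIn fun n =>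
    (Code.evaln_complete.1 (heval n)).imp fun t ht => Option.isSome_iff_exists.2 ⟨_, ht⟩
  refine ⟨Encodable.encode c, g, computableIn_empty_iff.1 hg, fun n t ht => ?_⟩
  obtain ⟨y, hy⟩ := Option.isSome_iff_exists.1 (hgspec n)
  obtain rfl := Part.mem_unique (Code.evaln_sound hy) (heval n)
  have hrun : Code.evaln t c n = some (Encodable.encode (D n)) := Code.evaln_mono ht hy
  simp [runFor, hrun]

end RunFor

/-- The list `D`, replaced by the empty list unless `clopen D` has measure less than `2 ^ (-k)`. -/
noncomputable def truncate (k : ℕ) (D : List (List Bool)) : List (List Bool) :=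
  if measureFloor D k = 0 then D else []

theorem primrec₂_truncate : Primrec₂ truncate :=
  Primrec.ite (Primrec.eq.comp (primrec₂_measureFloor.comp .snd .fst) (.const 0)) .snd (.const [])

theorem coinMeasure_truncate_le (k : ℕ) (D : List (List Bool)) :
    coinMeasure (clopen (truncate k D)) ≤ (2⁻¹ : ENNReal) ^ k := by
  rw [truncate]
  split_ifs with h
  · rw [measure_le_inv_two_pow_iff]
    simpa [h] using (lt_measureFloor_add_one_div D k).le
  · simp [clopen]

theorem truncate_eq_self {k : ℕ} {D : List (List Bool)}
    (hD : coinMeasure (clopen D) ≤ (2⁻¹ : ENNReal) ^ (k + 1)) : truncate k D = D := by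
  rw [measure_le_inv_two_pow_iff] at hD
  refine if_pos (Nat.floor_eq_zero.2 ?_)
  calc coinMeasure.real (clopen D) * 2 ^ k ≤ (1 / 2) ^ (k + 1) * 2 ^ k := by gcongr
    _ = 1 / 2 := by rw [pow_succ, mul_right_comm, ← mul_pow]; norm_num
    _ < 1 := by norm_num

/-- The strings that some program with number `e ≤ n`, run for `t` steps as if it computed a
Kurtz test, outputs as a clopen set of measure less than `2 ^ (-(n + e + 2))`.  The program is run
on input `n + e + 3`, so that `truncate`, whose inequality is strict, keeps a genuine test. -/
noncomputable def stageSet (n t : ℕ) : List (List Bool) :=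
  (List.range (n + 1)).flatMap fun e => truncate (n + e + 2) (runFor _ t e (n + e + 3))

theorem primrec₂_stageSet : Primrec₂ stageSet := by
  have hprogram (c : ℕ) : Primrec fun x : (ℕ × ℕ) × ℕ => x.1.1 + x.2 + c :=
    Primrec.nat_add.comp (Primrec.nat_add.comp (Primrec.fst.comp .fst) .snd) (.const c)
  exact Primrec.list_flatMap (Primrec.list_range.comp (Primrec.succ.comp .fst))
    (primrec₂_truncate.comp (hprogram 2) ((primrec_runFor _).comp
      (Primrec.pair (Primrec.snd.comp .fst) (Primrec.pair .snd (hprogram 3))))).to₂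

theorem coinMeasure_stageSet_le (n t : ℕ) :
    coinMeasure (clopen (stageSet n t)) ≤ (2⁻¹ : ENNReal) ^ (n + 1) := by
  let U : ℕ → Set Cantor := fun e => clopen (truncate (n + e + 2) (runFor _ t e (n + e + 3)))
  have hsub : clopen (stageSet n t) ⊆ ⋃ e, U e := fun X hX => by
    obtain ⟨e, -, he⟩ := mem_clopen_flatMap.1 hX
    exact Set.mem_iUnion.2 ⟨e, he⟩
  refine (measure_mono hsub).trans (measure_iUnion_le_inv_two_pow fun e => ?_)
  rw [show n + 1 + e + 1 = n + e + 2 by lia]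
  exact coinMeasure_truncate_le _ _

theorem clopen_subset_clopen_stageSet {D : ℕ → List (List Bool)} {e n t : ℕ} (he : e ≤ n)
    (hrun : runFor _ t e (n + e + 3) = D (n + e + 3))
    (hD : coinMeasure (clopen (D (n + e + 3))) ≤ (2⁻¹ : ENNReal) ^ (n + e + 3)) :
    clopen (D (n + e + 3)) ⊆ clopen (stageSet n t) := fun X hX =>
  mem_clopen_flatMap.2 ⟨e, List.mem_range.2 (Nat.lt_succ_of_le he), by
    rwa [hrun, truncate_eq_self hD]⟩

theorem IsOfHyperimmuneDegree.isSchnorrKurtzEngulfing {A : Cantor}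
    (hA : IsOfHyperimmuneDegree A) : IsSchnorrKurtzEngulfing A := by
  obtain ⟨f, hf, hdom⟩ := hA
  have hv : ComputableFrom A fun x : ℕ × ℕ => stageSet (x.1 + x.2) (f (x.1 + x.2)) := by
    have hadd : ComputableFrom A fun x : ℕ × ℕ => x.1 + x.2 := Primrec.nat_add.computableIn₂
    exact (computableIn_comp primrec₂_stageSet.computableIn₂
      (computableIn_pair hadd (computableIn_comp hf hadd)) :)
  refine ⟨_, isSchnorrTestIn_iUnion_clopen hv fun m j => coinMeasure_stageSet_le _ _, ?_⟩
  rintro X ⟨K, ⟨G, ⟨⟨D, hDc, hGD⟩, hGμ⟩, rfl⟩, hX⟩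
  refine Set.mem_iInter.2 fun m => ?_
  obtain ⟨e, g, hg, hrun⟩ := exists_runFor_eq hDc
  have hshift : Computable fun n => g (n + e + 3) :=
    hg.comp (Primrec.nat_add.comp (Primrec.nat_add.comp .id (.const e)) (.const 3)).to_comp
  have hfreq : ∃ᶠ n in atTop, g (n + e + 3) < f n := by
    simpa only [Filter.Frequently, not_lt] using hdom _ hshift
  obtain ⟨n, hn, hlt⟩ := (frequently_atTop.1 hfreq) (max m e)
  obtain ⟨j, rfl⟩ := Nat.exists_eq_add_of_le ((le_max_left m e).trans hn)
  refine Set.mem_iUnion.2 ⟨j, clopen_subset_clopen_stageSet ((le_max_right m e).trans hn)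
    (hrun _ _ hlt.le) (hGD _ ▸ hGμ _) ?_⟩
  rw [← hGD]
  exact Set.mem_iInter.1 hX _

end SchnorrKurtz

theorem theorem5p2 (A : SchnorrKurtz.Cantor) :
    SchnorrKurtz.IsOfHyperimmuneDegree A ↔ SchnorrKurtz.IsSchnorrKurtzEngulfing A :=
  ⟨SchnorrKurtz.IsOfHyperimmuneDegree.isSchnorrKurtzEngulfing,
    SchnorrKurtz.IsSchnorrKurtzEngulfing.isOfHyperimmuneDegree⟩
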